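/- Let $(G_i)_{i\in I}$ be a family of (discrete) groups and, for all $i\neq j$ in $I$, let $H_{ij}\le G_i$ be a subgroup and $\varphi_{ij}:H_{ij}\to H_{ji}$ a group isomorphism, with $\varphi_{ji}=\varphi_{ij}^{-1}$. The generalized free product of $(G_i)$ with amalgamated subgroups $(H_{ij})$ is the group $G$ with homomorphisms $\psi_i:G_i\to G$ such that $\psi_i|_{H_{ij}}=\psi_j\circ\varphi_{ij}$ for all $i\ne j$, and which is universal: for every group $K$ and all homomorphisms $f_i:G_i\to K$ with $f_i|_{H_{ij}}=f_j\circ\varphi_{ij}$ for all $i\neq j$ there is a unique homomorphism $F:G\to K$ with $F\circ\psi_i=f_i$ for all $i$. It is called realizable if every $\psi_i$ is injective. For a family $(A_i)$ of unital complex algebras (unital $*$-algebras, unital C*-algebras) with unital subalgebras ($*$-subalgebras, C*-subalgebras) $B_{ij}\subseteq A_i$ and isomorphisms $\varphi_{ij}:B_{ij}\to B_{ji}$, $\varphi_{ji}=\varphi_{ij}^{-1}$ ($i\ne j$), the generalized free product and its realizability are defined by the same universal property in the category of unital complex algebras (unital $*$-algebras, unital C*-algebras) and unital homomorphisms ($*$-homomorphisms),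 the product being generated, as an algebra (respectively, as a C*-algebra), by the images of the $A_i$. Let $\mathbb{C}[G]$ denote the complex group algebra, with involution $g^*=g^{-1}$, and $C^*(G)$ the full group C*-algebra, i.e. the completion of $\mathbb{C}[G]$ in the norm $\|x\|=\sup_\pi\|\pi(x)\|$, $\pi$ running over all unitary representations of $G$ on Hilbert spaces. Theorem. If the generalized free product of $(G_i)_{i\in I}$ with amalgamated subgroups $(H_{ij})$ is realizable, then: (i) for $i\ne j$ the maps $\mathbb{C}[H_{ij}]\to\mathbb{C}[G_i]$ induced by inclusion are injective, so that the $\mathbb{C}[H_{ij}]$, with the isomorphisms induced by the $\varphi_{ij}$, are amalgamated subalgebras, and the generalized free product of $(\mathbb{C}[G_i])_{i\in I}$ with amalgamated subalgebras $(\mathbb{C}[H_{ij}])$ exists and is realizable, both in the category of unital complex algebras and in that of unital complex $*$-algebras; (ii) for $i\ne j$ the maps $C^*(H_{ij})\to C^*(G_i)$ induced by inclusion are injective, so that the $C^*(H_{ij})$, with the isomorphisms induced by the $\varphi_{ij}$, are amalgamated C*-subalgebras, and the generalized free product of the unital C*-algebras $(C^*(G_i))_{i\in I}$ with amalgamated subalgebras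 $(C^*(H_{ij}))$ exists and is realizable. -/

import Mathlib

universe u

noncomputable section

namespace GenFreeProd

/-! ### Groups -/

/-- The maps `ψ i : G i → P` make the group `P` a generalized free product of the groups `G i`
with amalgamated subgroups `H i j` of `G i`, identified along `φ i j : H i j ≃ H j i`
(`i ≠ j`; the entries on the diagonal play no role). -/
structure IsGroupProduct {I : Type u} {G : I → Type u} [∀ i, Group (G i)]
    (H : ∀ i, I → Subgroup (G i)) (φ : ∀ i j, H i j ≃* H j i)
    {P : Type u} [Group P] (ψ : ∀ i, G i →* P) : Prop where
  comm : ∀ i j, i ≠ j → ∀ h : H i j, ψ i (h : G i) = ψ j (φ i j h : G j)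
  existsUnique_lift : ∀ (K : Type u) [Group K] (f : ∀ i, G i →* K),
    (∀ i j, i ≠ j → ∀ h : H i j, f i (h : G i) = f j (φ i j h : G j)) →
      ∃! F : P →* K, ∀ i, F.comp (ψ i) = f i

/-- The generalized free product of groups, which is unique up to isomorphism, is realizable:
its structure maps are injective. -/
def GroupRealizable {I : Type u} {G : I → Type u} [∀ i, Group (G i)]
    (H : ∀ i, I → Subgroup (G i)) (φ : ∀ i j, H i j ≃* H j i) : Prop :=
  ∃ (P : Type u) (_ : Group P) (ψ : ∀ i, G i →* P),
    IsGroupProduct H φ ψ ∧ ∀ i, Function.Injective (ψ i)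

/-! ### Unital complex algebras

The amalgamated subalgebras of `A i` are given as algebras `B i j` together with embeddings
`ι i j : B i j → A i`, and the identifications as isomorphisms `φ i j : B i j ≃ B j i`. -/

/-- The `B i j` are subalgebras of the `A i` (via `ι i j`), with mutually inverse
identifications. -/
structure IsAlgFamily {I : Type u} {A : I → Type u} {B : I → I → Type u}
    [∀ i, Ring (A i)] [∀ i, Algebra ℂ (A i)] [∀ i j, Ring (B i j)] [∀ i j, Algebra ℂ (B i j)]
    (ι : ∀ i j, B i j →ₐ[ℂ] A i) (φ : ∀ i j, B i j ≃ₐ[ℂ] B j i) : Prop where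
  injective : ∀ i j, i ≠ j → Function.Injective (ι i j)
  symm : ∀ i j, i ≠ j → φ j i = (φ i j).symm

/-- The maps `ψ i : A i → P` make `P` a generalized free product in the category of unital
complex algebras. -/
structure IsAlgProduct {I : Type u} {A : I → Type u} {B : I → I → Type u}
    [∀ i, Ring (A i)] [∀ i, Algebra ℂ (A i)] [∀ i j, Ring (B i j)] [∀ i j, Algebra ℂ (B i j)]
    (ι : ∀ i j, B i j →ₐ[ℂ] A i) (φ : ∀ i j, B i j ≃ₐ[ℂ] B j i)
    {P : Type u} [Ring P] [Algebra ℂ P] (ψ : ∀ i, A i →ₐ[ℂ] P) : Prop where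
  comm : ∀ i j, i ≠ j → ∀ b : B i j, ψ i (ι i j b) = ψ j (ι j i (φ i j b))
  generates : Algebra.adjoin ℂ (⋃ i, Set.range (ψ i)) = ⊤
  existsUnique_lift : ∀ (C : Type u) [Ring C] [Algebra ℂ C] (f : ∀ i, A i →ₐ[ℂ] C),
    (∀ i j, i ≠ j → ∀ b : B i j, f i (ι i j b) = f j (ι j i (φ i j b))) →
      ∃! F : P →ₐ[ℂ] C, ∀ i, F.comp (ψ i) = f i

/-- The `B i j` and their identifications form a family of amalgamated subalgebras, and the
resulting generalized free product of unital algebras is realizable. -/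
def AlgRealizable {I : Type u} {A : I → Type u} {B : I → I → Type u}
    [∀ i, Ring (A i)] [∀ i, Algebra ℂ (A i)] [∀ i j, Ring (B i j)] [∀ i j, Algebra ℂ (B i j)]
    (ι : ∀ i j, B i j →ₐ[ℂ] A i) (φ : ∀ i j, B i j ≃ₐ[ℂ] B j i) : Prop :=
  IsAlgFamily ι φ ∧
  ∃ (P : Type u) (_ : Ring P) (_ : Algebra ℂ P) (ψ : ∀ i, A i →ₐ[ℂ] P),
    IsAlgProduct ι φ ψ ∧ ∀ i, Function.Injective (ψ i)

/-! ### Unital complex *-algebras -/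

/-- The `B i j` are *-subalgebras of the `A i` (via `ι i j`), with mutually inverse
identifications. -/
structure IsStarAlgFamily {I : Type u} {A : I → Type u} {B : I → I → Type u}
    [∀ i, Ring (A i)] [∀ i, StarRing (A i)] [∀ i, Algebra ℂ (A i)] [∀ i, StarModule ℂ (A i)]
    [∀ i j, Ring (B i j)] [∀ i j, StarRing (B i j)] [∀ i j, Algebra ℂ (B i j)]
    [∀ i j, StarModule ℂ (B i j)]
    (ι : ∀ i j, B i j →⋆ₐ[ℂ] A i) (φ : ∀ i j, B i j ≃⋆ₐ[ℂ] B j i) : Prop where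
  injective : ∀ i j, i ≠ j → Function.Injective (ι i j)
  symm : ∀ i j, i ≠ j → φ j i = (φ i j).symm

/-- The maps `ψ i : A i → P` make `P` a generalized free product in the category of unital
complex *-algebras. -/
structure IsStarAlgProduct {I : Type u} {A : I → Type u} {B : I → I → Type u}
    [∀ i, Ring (A i)] [∀ i, StarRing (A i)] [∀ i, Algebra ℂ (A i)] [∀ i, StarModule ℂ (A i)]
    [∀ i j, Ring (B i j)] [∀ i j, StarRing (B i j)] [∀ i j, Algebra ℂ (B i j)]
    [∀ i j, StarModule ℂ (B i j)]
    (ι : ∀ i j, B i j →⋆ₐ[ℂ] A i) (φ : ∀ i j, B i j ≃⋆ₐ[ℂ] B j i)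
    {P : Type u} [Ring P] [StarRing P] [Algebra ℂ P] [StarModule ℂ P] (ψ : ∀ i, A i →⋆ₐ[ℂ] P) : Prop where
  comm : ∀ i j, i ≠ j → ∀ b : B i j, ψ i (ι i j b) = ψ j (ι j i (φ i j b))
  generates : Algebra.adjoin ℂ (⋃ i, Set.range (ψ i)) = ⊤
  existsUnique_lift : ∀ (C : Type u) [Ring C] [StarRing C] [Algebra ℂ C] [StarModule ℂ C]
    (f : ∀ i, A i →⋆ₐ[ℂ] C),
    (∀ i j, i ≠ j → ∀ b : B i j, f i (ι i j b) = f j (ι j i (φ i j b))) →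
      ∃! F : P →⋆ₐ[ℂ] C, ∀ i, F.comp (ψ i) = f i

/-- The `B i j` and their identifications form a family of amalgamated *-subalgebras, and the
resulting generalized free product of unital *-algebras is realizable. -/
def StarAlgRealizable {I : Type u} {A : I → Type u} {B : I → I → Type u}
    [∀ i, Ring (A i)] [∀ i, StarRing (A i)] [∀ i, Algebra ℂ (A i)] [∀ i, StarModule ℂ (A i)]
    [∀ i j, Ring (B i j)] [∀ i j, StarRing (B i j)] [∀ i j, Algebra ℂ (B i j)]
    [∀ i j, StarModule ℂ (B i j)]
    (ι : ∀ i j, B i j →⋆ₐ[ℂ] A i) (φ : ∀ i j, B i j ≃⋆ₐ[ℂ] B j i) : Prop :=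
  IsStarAlgFamily ι φ ∧
  ∃ (P : Type u) (_ : Ring P) (_ : StarRing P) (_ : Algebra ℂ P) (_ : StarModule ℂ P)
    (ψ : ∀ i, A i →⋆ₐ[ℂ] P),
    IsStarAlgProduct ι φ ψ ∧ ∀ i, Function.Injective (ψ i)

/-! ### Unital C*-algebras -/

/-- The maps `ψ i : A i → P` make `P` a generalized free product in the category of unital
C*-algebras and unital *-homomorphisms; `P` is generated by the images as a C*-algebra. -/
structure IsCStarProduct {I : Type u} {A : I → Type u} {B : I → I → Type u}
    [∀ i, CStarAlgebra (A i)] [∀ i j, CStarAlgebra (B i j)]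
    (ι : ∀ i j, B i j →⋆ₐ[ℂ] A i) (φ : ∀ i j, B i j ≃⋆ₐ[ℂ] B j i)
    {P : Type u} [CStarAlgebra P] (ψ : ∀ i, A i →⋆ₐ[ℂ] P) : Prop where
  comm : ∀ i j, i ≠ j → ∀ b : B i j, ψ i (ι i j b) = ψ j (ι j i (φ i j b))
  generates : (StarAlgebra.adjoin ℂ (⋃ i, Set.range (ψ i))).topologicalClosure = ⊤
  existsUnique_lift : ∀ (D : Type u) [CStarAlgebra D] (f : ∀ i, A i →⋆ₐ[ℂ] D),
    (∀ i j, i ≠ j → ∀ b : B i j, f i (ι i j b) = f j (ι j i (φ i j b))) →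
      ∃! F : P →⋆ₐ[ℂ] D, ∀ i, F.comp (ψ i) = f i

/-- The `B i j` and their identifications form a family of amalgamated C*-subalgebras, and the
resulting generalized free product of unital C*-algebras is realizable. (An injective
*-homomorphism of C*-algebras is isometric with closed range.) -/
def CStarRealizable {I : Type u} {A : I → Type u} {B : I → I → Type u}
    [∀ i, CStarAlgebra (A i)] [∀ i j, CStarAlgebra (B i j)]
    (ι : ∀ i j, B i j →⋆ₐ[ℂ] A i) (φ : ∀ i j, B i j ≃⋆ₐ[ℂ] B j i) : Prop :=
  IsStarAlgFamily ι φ ∧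
  ∃ (P : Type u) (_ : CStarAlgebra P) (ψ : ∀ i, A i →⋆ₐ[ℂ] P),
    IsCStarProduct ι φ ψ ∧ ∀ i, Function.Injective (ψ i)

/-! ### The group *-algebra `ℂ[G]` -/

section GroupAlgebra

variable {G K L : Type u} [Group G] [Group K] [Group L]

/-- The involution of `ℂ[G]`, conjugate linear with `g* = g⁻¹`: the coefficient of `star x` at
`g` is the conjugate of the coefficient of `x` at `g⁻¹`. -/
instance instStarGroupAlgebra : Star (MonoidAlgebra ℂ G) where
  star x := .ofCoeff ((x.coeff.equivMapDomain (Equiv.inv G)).mapRange star (star_zero ℂ))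

theorem coeff_star (x : MonoidAlgebra ℂ G) (g : G) :
    (star x).coeff g = star (x.coeff g⁻¹) := rfl

theorem star_single (g : G) (c : ℂ) :
    star (MonoidAlgebra.single g c) = MonoidAlgebra.single g⁻¹ (star c) := by
  classical
  ext k
  rw [coeff_star, MonoidAlgebra.coeff_single, MonoidAlgebra.coeff_single, Finsupp.single_apply,
    Finsupp.single_apply, apply_ite star, star_zero]
  simp only [inv_eq_iff_eq_inv]

theorem star_zero' : star (0 : MonoidAlgebra ℂ G) = 0 := by
  ext g; simp [coeff_star]

theorem star_add' (x y : MonoidAlgebra ℂ G) : star (x + y) = star x + star y := by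
  ext g; simp [coeff_star]

instance instStarRingGroupAlgebra : StarRing (MonoidAlgebra ℂ G) where
  star_involutive x := by ext g; simp [coeff_star]
  star_mul x y := by
    induction x using MonoidAlgebra.induction_linear with
    | zero => simp [star_zero']
    | add x₁ x₂ h₁ h₂ => rw [add_mul, star_add', h₁, h₂, star_add', mul_add]
    | single g c =>
      induction y using MonoidAlgebra.induction_linear with
      | zero => simp [star_zero']
      | add y₁ y₂ h₁ h₂ => rw [mul_add, star_add', h₁, h₂, star_add', add_mul]
      | single k d => simp [star_single, MonoidAlgebra.single_mul_single, mul_comm]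
  star_add := star_add'

instance instStarModuleGroupAlgebra : StarModule ℂ (MonoidAlgebra ℂ G) where
  star_smul c x := by ext g; simp [coeff_star]

/-- The *-homomorphism `ℂ[G] → ℂ[K]` induced by a group homomorphism `G → K`. -/
def groupAlgMap (f : G →* K) : MonoidAlgebra ℂ G →⋆ₐ[ℂ] MonoidAlgebra ℂ K where
  toAlgHom := MonoidAlgebra.mapDomainAlgHom ℂ ℂ f
  map_star' x := by
    change MonoidAlgebra.mapDomainAlgHom ℂ ℂ f (star x)
      = star (MonoidAlgebra.mapDomainAlgHom ℂ ℂ f x)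
    induction x using MonoidAlgebra.induction_linear with
    | zero => simp
    | add x y hx hy => rw [star_add, map_add, hx, hy, map_add, star_add]
    | single g c => simp [star_single]

theorem groupAlgMap_single (f : G →* K) (g : G) (c : ℂ) :
    groupAlgMap f (MonoidAlgebra.single g c) = MonoidAlgebra.single (f g) c :=
  MonoidAlgebra.mapDomain_single

theorem groupAlgMap_comp (f : G →* K) (f' : K →* L) (x : MonoidAlgebra ℂ G) :
    groupAlgMap f' (groupAlgMap f x) = groupAlgMap (f'.comp f) x := by
  induction x using MonoidAlgebra.induction_linear with
  | zero => simp
  | add x y hx hy => rw [map_add, map_add, map_add, hx, hy]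
  | single g c => simp [groupAlgMap_single]

theorem groupAlgMap_id (x : MonoidAlgebra ℂ G) : groupAlgMap (MonoidHom.id G) x = x := by
  induction x using MonoidAlgebra.induction_linear with
  | zero => simp
  | add x y hx hy => rw [map_add, hx, hy]
  | single g c => simp [groupAlgMap_single]

/-- The *-isomorphism `ℂ[G] ≃ ℂ[K]` induced by a group isomorphism `G ≃ K`. -/
def groupAlgCongr (e : G ≃* K) : MonoidAlgebra ℂ G ≃⋆ₐ[ℂ] MonoidAlgebra ℂ K :=
  StarAlgEquiv.ofStarAlgHom (groupAlgMap e.toMonoidHom) (groupAlgMap e.symm.toMonoidHom)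
    (by ext x; simp [groupAlgMap_comp, groupAlgMap_id])
    (by ext x; simp [groupAlgMap_comp, groupAlgMap_id])

end GroupAlgebra

/-! ### The full group C*-algebra `C*(G)` of a discrete group -/

variable {G K L : Type u} [Group G] [Group K] [Group L]

section Rep

variable {E : Type u} [NormedAddCommGroup E] [InnerProductSpace ℂ E] [CompleteSpace E]

/-- The representation of `ℂ[G]` on a Hilbert space that extends a unitary representation
of `G`. -/
def repExt (π : G →* unitary (E →L[ℂ] E)) : MonoidAlgebra ℂ G →ₐ[ℂ] (E →L[ℂ] E) :=
  MonoidAlgebra.lift ℂ (E →L[ℂ] E) G ((unitary (E →L[ℂ] E)).subtype.comp π)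

theorem repExt_single (π : G →* unitary (E →L[ℂ] E)) (g : G) (c : ℂ) :
    repExt π (MonoidAlgebra.single g c) = c • (π g : E →L[ℂ] E) := by
  simp [repExt, MonoidAlgebra.lift_single]

theorem repExt_star (π : G →* unitary (E →L[ℂ] E)) (x : MonoidAlgebra ℂ G) :
    repExt π (star x) = star (repExt π x) := by
  induction x using MonoidAlgebra.induction_linear with
  | zero => simp
  | add x y hx hy => rw [star_add, map_add, hx, hy, map_add, star_add]
  | single g c =>
    rw [star_single, repExt_single, repExt_single, star_smul, map_inv, ← Unitary.star_eq_inv,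
      Unitary.coe_star]

theorem repExt_map (f : G →* K) (π : K →* unitary (E →L[ℂ] E)) (x : MonoidAlgebra ℂ G) :
    repExt π (groupAlgMap f x) = repExt (π.comp f) x := by
  induction x using MonoidAlgebra.induction_linear with
  | zero => simp
  | add x y hx hy => rw [map_add, map_add, hx, hy, map_add]
  | single g c => rw [groupAlgMap_single, repExt_single, repExt_single]; rfl

theorem norm_repExt_le (π : G →* unitary (E →L[ℂ] E)) (x : MonoidAlgebra ℂ G) :
    ‖repExt π x‖ ≤ ∑ g ∈ x.coeff.support, ‖x.coeff g‖ := by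
  have h : repExt π x = ∑ g ∈ x.coeff.support, x.coeff g • (π g : E →L[ℂ] E) := by
    rw [repExt, MonoidAlgebra.lift_apply]; rfl
  rw [h]
  refine (norm_sum_le _ _).trans (Finset.sum_le_sum fun g _ => ?_)
  rw [norm_smul]
  refine mul_le_of_le_one_right (norm_nonneg _) ?_
  refine ContinuousLinearMap.opNorm_le_bound _ zero_le_one fun v => ?_
  rw [ContinuousLinearMap.norm_map_of_mem_unitary (π g).2, one_mul]

end Rep

/-- The numbers `‖π x‖`, where `π` runs over all unitary representations of `G` on Hilbert
spaces. -/
def repNorms (x : MonoidAlgebra ℂ G) : Set ℝ :=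
  {r | ∃ (E : Type u) (_ : NormedAddCommGroup E) (_ : InnerProductSpace ℂ E)
    (_ : CompleteSpace E) (π : G →* unitary (E →L[ℂ] E)), r = ‖repExt π x‖}

theorem repNorms_bddAbove (x : MonoidAlgebra ℂ G) : BddAbove (repNorms x) := by
  refine ⟨∑ g ∈ x.coeff.support, ‖x.coeff g‖, ?_⟩
  rintro r ⟨E, _, _, _, π, rfl⟩
  exact norm_repExt_le π x

/-- The full (universal) C*-norm of `ℂ[G]`: the supremum of `‖π x‖` over all unitary
representations `π` of `G` on Hilbert spaces. -/
def fullNorm (x : MonoidAlgebra ℂ G) : ℝ := sSup (repNorms x)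

theorem norm_repExt_le_fullNorm {E : Type u} [NormedAddCommGroup E] [InnerProductSpace ℂ E]
    [CompleteSpace E] (π : G →* unitary (E →L[ℂ] E)) (x : MonoidAlgebra ℂ G) :
    ‖repExt π x‖ ≤ fullNorm x :=
  le_csSup (repNorms_bddAbove x) ⟨E, _, _, _, π, rfl⟩

theorem fullNorm_le {x : MonoidAlgebra ℂ G} {c : ℝ} (hc : 0 ≤ c)
    (h : ∀ (E : Type u) [NormedAddCommGroup E] [InnerProductSpace ℂ E] [CompleteSpace E]
      (π : G →* unitary (E →L[ℂ] E)), ‖repExt π x‖ ≤ c) : fullNorm x ≤ c := by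
  refine Real.sSup_le ?_ hc
  rintro r ⟨E, _, _, _, π, rfl⟩
  exact h E π

theorem fullNorm_nonneg (x : MonoidAlgebra ℂ G) : 0 ≤ fullNorm x := by
  refine Real.sSup_nonneg ?_
  rintro r ⟨E, _, _, _, π, rfl⟩
  exact norm_nonneg _

/-- The full norm as a ring seminorm. -/
def fullSeminorm (G : Type u) [Group G] : RingSeminorm (MonoidAlgebra ℂ G) where
  toFun := fullNorm
  map_zero' := le_antisymm
    (fullNorm_le le_rfl fun E _ _ _ π => by rw [map_zero, norm_zero]) (fullNorm_nonneg _)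
  add_le' x y := fullNorm_le (add_nonneg (fullNorm_nonneg x) (fullNorm_nonneg y))
    fun E _ _ _ π => by
      rw [map_add]
      exact (norm_add_le _ _).trans
        (add_le_add (norm_repExt_le_fullNorm π x) (norm_repExt_le_fullNorm π y))
  neg' x := by
    have h : repNorms (-x) = repNorms x := by simp only [repNorms, map_neg, norm_neg]
    simp only [fullNorm, h]
  mul_le' x y := fullNorm_le (mul_nonneg (fullNorm_nonneg x) (fullNorm_nonneg y))
    fun E _ _ _ π => by
      rw [map_mul]
      exact (norm_mul_le _ _).trans
        (mul_le_mul (norm_repExt_le_fullNorm π x) (norm_repExt_le_fullNorm π y)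
          (norm_nonneg _) (fullNorm_nonneg x))

theorem fullNorm_smul_le (c : ℂ) (x : MonoidAlgebra ℂ G) :
    fullNorm (c • x) ≤ ‖c‖ * fullNorm x :=
  fullNorm_le (mul_nonneg (norm_nonneg _) (fullNorm_nonneg x)) fun E _ _ _ π => by
    rw [map_smul, norm_smul]
    exact mul_le_mul_of_nonneg_left (norm_repExt_le_fullNorm π x) (norm_nonneg _)

theorem fullNorm_star (x : MonoidAlgebra ℂ G) : fullNorm (star x) = fullNorm x := by
  have h : repNorms (star x) = repNorms x := by simp only [repNorms, repExt_star, norm_star]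
  simp only [fullNorm, h]

theorem fullNorm_sq_le (x : MonoidAlgebra ℂ G) :
    fullNorm x * fullNorm x ≤ fullNorm (star x * x) := by
  have h : fullNorm x ≤ Real.sqrt (fullNorm (star x * x)) :=
    fullNorm_le (Real.sqrt_nonneg _) fun E _ _ _ π => by
      refine Real.le_sqrt_of_sq_le ?_
      rw [sq, ← CStarRing.norm_star_mul_self, ← repExt_star, ← map_mul]
      exact norm_repExt_le_fullNorm π _
  calc fullNorm x * fullNorm x
      ≤ Real.sqrt (fullNorm (star x * x)) * Real.sqrt (fullNorm (star x * x)) :=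
        mul_le_mul h h (fullNorm_nonneg x) (Real.sqrt_nonneg _)
    _ = fullNorm (star x * x) := Real.mul_self_sqrt (fullNorm_nonneg _)

theorem fullNorm_map_le (f : G →* K) (x : MonoidAlgebra ℂ G) :
    fullNorm (groupAlgMap f x) ≤ fullNorm x :=
  fullNorm_le (fullNorm_nonneg x) fun E _ _ _ π => by
    rw [repExt_map]; exact norm_repExt_le_fullNorm _ x

/-- The group *-algebra `ℂ[G]`, equipped with its full norm. -/
def FullPre (G : Type u) [Group G] : Type u := MonoidAlgebra ℂ G

namespace FullPre

instance : SeminormedRing (FullPre G) := (fullSeminorm G).toSeminormedRing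

instance : StarRing (FullPre G) := inferInstanceAs (StarRing (MonoidAlgebra ℂ G))

theorem norm_def (x : FullPre G) : ‖x‖ = fullNorm (G := G) x := rfl

instance : Algebra ℂ (FullPre G) := inferInstanceAs (Algebra ℂ (MonoidAlgebra ℂ G))

instance : NormedAlgebra ℂ (FullPre G) where
  norm_smul_le c x := fullNorm_smul_le (G := G) c x

instance : StarModule ℂ (FullPre G) := inferInstanceAs (StarModule ℂ (MonoidAlgebra ℂ G))

instance : NormedStarGroup (FullPre G) where
  norm_star_le x := (fullNorm_star (G := G) x).le

/-- The *-homomorphism of the dense subalgebras induced by a group homomorphism. -/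
def map (f : G →* K) : FullPre G →⋆ₐ[ℂ] FullPre K := groupAlgMap f

theorem norm_map_le (f : G →* K) (x : FullPre G) : ‖map f x‖ ≤ ‖x‖ := fullNorm_map_le f x

theorem continuous_map (f : G →* K) : Continuous (map f) :=
  AddMonoidHomClass.continuous_of_bound (map f) 1 fun x => by
    rw [one_mul]; exact norm_map_le f x

theorem uniformContinuous_map (f : G →* K) : UniformContinuous (map f) :=
  uniformContinuous_addMonoidHom_of_continuous (continuous_map f)

end FullPre

open UniformSpace in
/-- The full group C*-algebra `C*(G)` of the discrete group `G`: the (Hausdorff) completion of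
`ℂ[G]` with respect to the full norm. -/
def GroupCStar (G : Type u) [Group G] : Type u := Completion (FullPre G)

namespace GroupCStar

open UniformSpace

instance : NormedRing (GroupCStar G) := inferInstanceAs (NormedRing (Completion (FullPre G)))

instance : CompleteSpace (GroupCStar G) :=
  inferInstanceAs (CompleteSpace (Completion (FullPre G)))

instance : Algebra ℂ (GroupCStar G) :=
  inferInstanceAs (Algebra ℂ (Completion (FullPre G)))

instance : NormedAlgebra ℂ (GroupCStar G) where
  norm_smul_le c x := norm_smul_le (α := ℂ) (β := Completion (FullPre G)) c x

/-- The canonical map `ℂ[G] → C*(G)`. -/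
def incl (x : FullPre G) : GroupCStar G := (x : Completion (FullPre G))

theorem continuous_incl : Continuous (incl : FullPre G → GroupCStar G) :=
  Completion.continuous_coe _

theorem denseRange_incl : DenseRange (incl : FullPre G → GroupCStar G) :=
  Completion.denseRange_coe

theorem norm_incl (x : FullPre G) : ‖incl x‖ = ‖x‖ := Completion.norm_coe x

theorem incl_add (x y : FullPre G) : incl (x + y) = incl x + incl y := Completion.coe_add x y

theorem incl_mul (x y : FullPre G) : incl (x * y) = incl x * incl y := Completion.coe_mul x y

theorem incl_smul (c : ℂ) (x : FullPre G) : incl (c • x) = c • incl x := Completion.coe_smul c x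

/-- The involution of `C*(G)` extends that of `ℂ[G]` by continuity. -/
instance : Star (GroupCStar G) where
  star := Completion.map (star : FullPre G → FullPre G)

theorem continuous_star' : Continuous (star : GroupCStar G → GroupCStar G) :=
  Completion.continuous_map

theorem star_incl (x : FullPre G) : star (incl x) = incl (star x) :=
  Completion.map_coe (starNormedAddGroupHom.uniformContinuous) x

theorem induction {p : GroupCStar G → Prop} (x : GroupCStar G) (hp : IsClosed {x | p x})
    (h : ∀ x, p (incl x)) : p x := denseRange_incl.induction_on x hp h

instance : StarRing (GroupCStar G) where
  star_involutive x := by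
    induction x using induction with
    | hp => exact isClosed_eq (continuous_star'.comp continuous_star') continuous_id
    | h x => rw [star_incl, star_incl, star_star]
  star_mul x y := by
    induction x using induction with
    | hp => exact isClosed_eq (continuous_star'.comp (continuous_mul_const y))
              ((continuous_const_mul (star y)).comp continuous_star')
    | h x =>
      induction y using induction with
      | hp => exact isClosed_eq (continuous_star'.comp (continuous_const_mul _))
                ((continuous_mul_const _).comp continuous_star')
      | h y => rw [← incl_mul, star_incl, star_incl, star_incl, star_mul, incl_mul]
  star_add x y := by
    induction x using induction with
    | hp => exact isClosed_eq (continuous_star'.comp (continuous_add_const y))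
              ((continuous_add_const (star y)).comp continuous_star')
    | h x =>
      induction y using induction with
      | hp => exact isClosed_eq (continuous_star'.comp (continuous_const_add _))
                ((continuous_const_add _).comp continuous_star')
      | h y => rw [← incl_add, star_incl, star_incl, star_incl, star_add, incl_add]

instance : StarModule ℂ (GroupCStar G) where
  star_smul c x := by
    induction x using induction with
    | hp => exact isClosed_eq (continuous_star'.comp (continuous_const_smul c))
              ((continuous_const_smul (star c)).comp continuous_star')
    | h x => rw [← incl_smul, star_incl, star_incl, star_smul, incl_smul]

instance : CStarRing (GroupCStar G) where
  norm_mul_self_le x := by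
    induction x using induction with
    | hp => exact isClosed_le (continuous_norm.mul continuous_norm)
              (continuous_norm.comp (continuous_star'.mul continuous_id))
    | h x =>
      rw [star_incl, ← incl_mul, norm_incl, norm_incl]
      exact fullNorm_sq_le (G := G) x

instance : CStarAlgebra (GroupCStar G) where

/-- The continuous extension `C*(G) → C*(K)` of the map `ℂ[G] → ℂ[K]` induced by a group
homomorphism `G → K`. -/
def mapFun (f : G →* K) : GroupCStar G → GroupCStar K := Completion.map (FullPre.map f)

theorem continuous_mapFun (f : G →* K) : Continuous (mapFun f) := Completion.continuous_map

theorem mapFun_incl (f : G →* K) (x : FullPre G) : mapFun f (incl x) = incl (FullPre.map f x) :=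
  Completion.map_coe (FullPre.uniformContinuous_map f) x

/-- The *-homomorphism `C*(G) → C*(K)` induced by a group homomorphism `G → K`. -/
def map (f : G →* K) : GroupCStar G →⋆ₐ[ℂ] GroupCStar K where
  toFun := mapFun f
  map_one' := (mapFun_incl f 1).trans (congrArg incl (map_one (FullPre.map f)))
  map_mul' x y := by
    induction x using induction with
    | hp => exact isClosed_eq ((continuous_mapFun f).comp (continuous_mul_const y))
              ((continuous_mul_const _).comp (continuous_mapFun f))
    | h x =>
      induction y using induction with
      | hp => exact isClosed_eq ((continuous_mapFun f).comp (continuous_const_mul _))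
                ((continuous_const_mul _).comp (continuous_mapFun f))
      | h y => rw [← incl_mul, mapFun_incl, mapFun_incl, mapFun_incl, map_mul, incl_mul]
  map_zero' := (mapFun_incl f 0).trans (congrArg incl (map_zero (FullPre.map f)))
  map_add' x y := by
    induction x using induction with
    | hp => exact isClosed_eq ((continuous_mapFun f).comp (continuous_add_const y))
              ((continuous_add_const _).comp (continuous_mapFun f))
    | h x =>
      induction y using induction with
      | hp => exact isClosed_eq ((continuous_mapFun f).comp (continuous_const_add _))
                ((continuous_const_add _).comp (continuous_mapFun f))
      | h y => rw [← incl_add, mapFun_incl, mapFun_incl, mapFun_incl, map_add, incl_add]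
  commutes' c := (mapFun_incl f (algebraMap ℂ _ c)).trans
    (congrArg incl (AlgHomClass.commutes (FullPre.map f) c))
  map_star' x := by
    induction x using induction with
    | hp => exact isClosed_eq ((continuous_mapFun f).comp continuous_star')
              (continuous_star'.comp (continuous_mapFun f))
    | h x => rw [star_incl, mapFun_incl, mapFun_incl, star_incl, map_star]

theorem map_incl (f : G →* K) (x : FullPre G) : map f (incl x) = incl (FullPre.map f x) :=
  mapFun_incl f x

theorem map_comp (f : G →* K) (f' : K →* L) (x : GroupCStar G) :
    map f' (map f x) = map (f'.comp f) x := by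
  induction x using induction with
  | hp => exact isClosed_eq ((continuous_mapFun f').comp (continuous_mapFun f))
            (continuous_mapFun _)
  | h x =>
    rw [map_incl, map_incl, map_incl]
    exact congrArg incl (groupAlgMap_comp f f' x)

theorem map_id (x : GroupCStar G) : map (MonoidHom.id G) x = x := by
  induction x using induction with
  | hp => exact isClosed_eq (continuous_mapFun _) continuous_id
  | h x =>
    rw [map_incl]
    exact congrArg incl (groupAlgMap_id x)

/-- The *-isomorphism `C*(G) ≃ C*(K)` induced by a group isomorphism `G ≃ K`. -/
def congr (e : G ≃* K) : GroupCStar G ≃⋆ₐ[ℂ] GroupCStar K :=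
  StarAlgEquiv.ofStarAlgHom (map e.toMonoidHom) (map e.symm.toMonoidHom)
    (by ext x; simp [map_comp, map_id])
    (by ext x; simp [map_comp, map_id])

end GroupCStar

end GenFreeProd
end

/-! The product of the group algebras is the group algebra of the product group `P`, in all three
categories, because each universal property reduces to that of `P`. Homomorphisms `ℂ[G] → C` are the
same as group homomorphisms `G → Cˣ`, and *-homomorphisms `ℂ[G] → C` the same as homomorphisms of
`G` into the unitary group of `C`. A compatible family on the algebras thus becomes a compatible
family on the groups, which factors through `P` and extends back to `ℂ[P]`.

For `C*(G)` the same correspondence holds with unitary groups of C*-algebras, but extending by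
continuity needs `norm_unitaryLift_le`. The full norm is defined by Hilbert space representations
only, so an arbitrary C*-algebra has to be represented on a Hilbert space without lowering the norm
of a given element (`exists_norm_le_norm_rep`). This is the GNS construction for a state that
attains the norm of `a* a`.

Injectivity is immediate for `ℂ[G]`. For `C*(G)` it does not follow from injectivity on the dense
subalgebra; instead an injective group homomorphism induces an isometry (`GroupCStar.norm_map`). For
a subgroup `K ≤ G`, every unitary representation of `K` is contained in the restriction of its
induced representation of `G`, so the full norm of `ℂ[K]` is at most that of `ℂ[G]`. Applied to the
inclusions of the `H i j` this gives the amalgamated subalgebras, applied to the `ψ i`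
realizability. -/

namespace GenFreeProd

/-! ### Generation and lifting for products of groups. -/

namespace IsGroupProduct

variable {I : Type u} {G : I → Type u} [∀ i, Group (G i)]
  {H : ∀ i, I → Subgroup (G i)} {φ : ∀ i j, H i j ≃* H j i}
  {P : Type u} [Group P] {ψ : ∀ i, G i →* P}

theorem hom_ext (hP : IsGroupProduct H φ ψ) {K : Type u} [Group K] {F F' : P →* K}
    (h : ∀ i g, F (ψ i g) = F' (ψ i g)) : F = F' := by
  obtain ⟨E, -, hE⟩ := hP.existsUnique_lift K (fun i => F'.comp (ψ i)) fun i j hij x =>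
    congrArg F' (hP.comm i j hij x)
  exact (hE F fun i => MonoidHom.ext (h i)).trans (hE F' fun i => rfl).symm

/-- A generalized free product of groups is generated by the images of the factors. -/
theorem eq_top (hP : IsGroupProduct H φ ψ) (S : Subgroup P) (hS : ∀ i g, ψ i g ∈ S) : S = ⊤ := by
  obtain ⟨E, hE, -⟩ := hP.existsUnique_lift S (fun i => (ψ i).codRestrict S (hS i))
    fun i j hij x => Subtype.ext (hP.comm i j hij x)
  -- Followed by the inclusion of `S`, the lift fixes the images of the factors, so it is the
  -- identity and every element lies in `S`.
  have h : S.subtype.comp E = MonoidHom.id P := hP.hom_ext fun i g =>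
    congrArg Subtype.val (DFunLike.congr_fun (hE i) g)
  refine (Subgroup.eq_top_iff' S).2 fun x => ?_
  rw [show x = (E x : P) from (DFunLike.congr_fun h x).symm]
  exact (E x).2

theorem exists_lift (hP : IsGroupProduct H φ ψ) {K : Type u} [Group K] (f : ∀ i, G i →* K)
    (hf : ∀ i j, i ≠ j → ∀ h : H i j, f i (h : G i) = f j (φ i j h : G j)) :
    ∃ F : P →* K, ∀ i g, F (ψ i g) = f i g := by
  obtain ⟨F, hF, -⟩ := hP.existsUnique_lift K f hf
  exact ⟨F, fun i => DFunLike.congr_fun (hF i)⟩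

/-- A predicate on the product that holds on the factors and is compatible with the group
operations holds everywhere. -/
theorem induction (hP : IsGroupProduct H φ ψ) {p : P → Prop} (hψ : ∀ i g, p (ψ i g))
    (h1 : p 1) (hmul : ∀ x y, p x → p y → p (x * y)) (hinv : ∀ x, p x → p x⁻¹) (x : P) : p x := by
  have h := hP.eq_top
    { carrier := {x | p x}, mul_mem' := hmul _ _, one_mem' := h1, inv_mem' := hinv _ } hψ
  have hx : x ∈ (⊤ : Subgroup P) := trivial
  rw [← h] at hx
  exact hx

end IsGroupProduct

/-! ### Homomorphisms on `ℂ[G]` as homomorphisms into units and unitaries. -/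

section Lift

variable {G : Type u} [Group G]

theorem single_mul_single_inv (g : G) :
    (MonoidAlgebra.single g 1 * MonoidAlgebra.single g⁻¹ 1 : MonoidAlgebra ℂ G) = 1 := by
  rw [MonoidAlgebra.single_mul_single, mul_inv_cancel, one_mul, MonoidAlgebra.one_def]

/-- The homomorphism from `G` to the units of an algebra given by a homomorphism on `ℂ[G]`. -/
noncomputable def unitsHom {C : Type u} [Ring C] [Algebra ℂ C] (f : MonoidAlgebra ℂ G →ₐ[ℂ] C) :
    G →* Cˣ :=
  ((f : MonoidAlgebra ℂ G →* C).comp (MonoidAlgebra.of ℂ G)).toHomUnits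

theorem coe_unitsHom {C : Type u} [Ring C] [Algebra ℂ C] (f : MonoidAlgebra ℂ G →ₐ[ℂ] C) (g : G) :
    (unitsHom f g : C) = f (MonoidAlgebra.single g 1) := rfl

theorem algHom_ext {C : Type u} [Ring C] [Algebra ℂ C] {f f' : MonoidAlgebra ℂ G →ₐ[ℂ] C}
    (h : ∀ g, f (MonoidAlgebra.single g 1) = f' (MonoidAlgebra.single g 1)) : f = f' :=
  MonoidAlgebra.algHom_ext h (Subsingleton.elim _ _)

theorem single_mem_unitary (g : G) :
    MonoidAlgebra.single g 1 ∈ unitary (MonoidAlgebra ℂ G) := by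
  rw [Unitary.mem_iff, star_single, star_one]
  refine ⟨?_, single_mul_single_inv g⟩
  simpa using single_mul_single_inv g⁻¹

/-- The homomorphism from `G` to the unitary group of a *-algebra given by a *-homomorphism on
`ℂ[G]`. -/
noncomputable def unitaryHom {C : Type u} [Ring C] [StarRing C] [Algebra ℂ C]
    (f : MonoidAlgebra ℂ G →⋆ₐ[ℂ] C) : G →* unitary C :=
  ((f : MonoidAlgebra ℂ G →* C).comp (MonoidAlgebra.of ℂ G)).codRestrict (unitary C)
    fun g => Unitary.map_mem f (single_mem_unitary g)

theorem coe_unitaryHom {C : Type u} [Ring C] [StarRing C] [Algebra ℂ C]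
    (f : MonoidAlgebra ℂ G →⋆ₐ[ℂ] C) (g : G) :
    (unitaryHom f g : C) = f (MonoidAlgebra.single g 1) := rfl

theorem starAlgHom_ext {C : Type u} [Ring C] [StarRing C] [Algebra ℂ C]
    {f f' : MonoidAlgebra ℂ G →⋆ₐ[ℂ] C}
    (h : ∀ g, f (MonoidAlgebra.single g 1) = f' (MonoidAlgebra.single g 1)) : f = f' := by
  have := algHom_ext (f := f.toAlgHom) (f' := f'.toAlgHom) h
  exact StarAlgHom.ext fun x => DFunLike.congr_fun this x

/-- The *-homomorphism on `ℂ[G]` extending a homomorphism of `G` to the unitary group of a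
*-algebra. -/
noncomputable def unitaryLift {C : Type u} [Ring C] [StarRing C] [Algebra ℂ C] [StarModule ℂ C]
    (u : G →* unitary C) : MonoidAlgebra ℂ G →⋆ₐ[ℂ] C where
  toAlgHom := MonoidAlgebra.lift ℂ C G ((unitary C).subtype.comp u)
  map_star' x := by
    change MonoidAlgebra.lift ℂ C G ((unitary C).subtype.comp u) (star x)
      = star (MonoidAlgebra.lift ℂ C G ((unitary C).subtype.comp u) x)
    induction x using MonoidAlgebra.induction_linear with
    | zero => simp
    | add x y hx hy => rw [star_add, map_add, hx, hy, map_add, star_add]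
    | single g c =>
      rw [star_single, MonoidAlgebra.lift_single, MonoidAlgebra.lift_single, star_smul,
        MonoidHom.comp_apply, MonoidHom.comp_apply, map_inv, ← Unitary.star_eq_inv]
      rfl

theorem unitaryLift_single {C : Type u} [Ring C] [StarRing C] [Algebra ℂ C] [StarModule ℂ C]
    (u : G →* unitary C) (g : G) (c : ℂ) :
    unitaryLift u (MonoidAlgebra.single g c) = c • (u g : C) :=
  MonoidAlgebra.lift_single _ _ _

end Lift

theorem groupAlgMap_injective {G K : Type u} [Group G] [Group K] {f : G →* K}
    (hf : Function.Injective f) : Function.Injective (groupAlgMap f) :=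
  MonoidAlgebra.mapDomain_injective hf

/-! ### The algebra and *-algebra `ℂ[P]` as a generalized free product. -/

section Products

variable {I : Type u} {G : I → Type u} [∀ i, Group (G i)]
  {H : ∀ i, I → Subgroup (G i)} {φ : ∀ i j, H i j ≃* H j i}
  {P : Type u} [Group P] {ψ : ∀ i, G i →* P}

theorem IsGroupProduct.adjoin_groupAlg (hP : IsGroupProduct H φ ψ) :
    Algebra.adjoin ℂ (⋃ i, Set.range (groupAlgMap (ψ i))) = ⊤ := by
  set S := Algebra.adjoin ℂ (⋃ i, Set.range (groupAlgMap (ψ i))) with hS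
  have hψ : ∀ i (g : G i), MonoidAlgebra.single (ψ i g) (1 : ℂ) ∈ S := fun i g =>
    Algebra.subset_adjoin
      (Set.mem_iUnion.2 ⟨i, MonoidAlgebra.single g 1, groupAlgMap_single (ψ i) g 1⟩)
  -- The inverse is carried along because `S` is only a subalgebra and gives no closure under
  -- inverses.
  have key : ∀ x : P, MonoidAlgebra.single x (1 : ℂ) ∈ S ∧ MonoidAlgebra.single x⁻¹ (1 : ℂ) ∈ S := by
    refine hP.induction (fun i g => ⟨hψ i g, ?_⟩) ?_ (fun x y hx hy => ⟨?_, ?_⟩) fun x hx => ?_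
    · rw [← map_inv]
      exact hψ i g⁻¹
    · rw [inv_one, ← MonoidAlgebra.one_def]
      exact ⟨one_mem S, one_mem S⟩
    · simpa [MonoidAlgebra.single_mul_single] using mul_mem hx.1 hy.1
    · simpa [MonoidAlgebra.single_mul_single] using mul_mem hy.2 hx.2
    · rw [inv_inv]
      exact hx.symm
  refine Algebra.eq_top_iff.2 fun x => ?_
  induction x using MonoidAlgebra.induction_linear with
  | zero => exact zero_mem S
  | add x y hx hy => exact add_mem hx hy
  | single g c => simpa using S.smul_mem (key g).1 c

/-- Group elements are invertible in `ℂ[G]`, so a compatible family into `C` restricts to a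
compatible family of groups into `Cˣ`. Its factorization through `P` extends linearly, and
uniqueness holds because any other factorization also restricts to a homomorphism `P → Cˣ`. -/
theorem IsGroupProduct.isAlgProduct (hP : IsGroupProduct H φ ψ) :
    IsAlgProduct (fun i j => MonoidAlgebra.mapDomainAlgHom ℂ ℂ (H i j).subtype)
      (fun i j => MonoidAlgebra.domCongr ℂ ℂ (φ i j))
      (fun i => MonoidAlgebra.mapDomainAlgHom ℂ ℂ (ψ i)) where
  comm i j hij b := by
    induction b using MonoidAlgebra.induction_linear with
    | zero => simp
    | add x y hx hy => simp only [map_add, hx, hy]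
    | single h c => simp [hP.comm i j hij h]
  generates := hP.adjoin_groupAlg
  existsUnique_lift C _ _ f hf := by
    obtain ⟨F, hF⟩ := hP.exists_lift (fun i => unitsHom (f i)) fun i j hij h => by
      ext
      simpa [coe_unitsHom] using hf i j hij (MonoidAlgebra.single h 1)
    refine ⟨MonoidAlgebra.lift ℂ C P ((Units.coeHom C).comp F), fun i => algHom_ext fun g => ?_,
      fun F' hF' => algHom_ext fun x => ?_⟩
    · simp [hF, coe_unitsHom]
    · have h : unitsHom F' = F := hP.hom_ext fun i g => by
        ext
        simp [hF, coe_unitsHom, ← hF' i]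
      simp [← h, coe_unitsHom]

/-- The argument for algebras applies with the unitary group of `C` in place of `Cˣ`: group elements
are unitary in `ℂ[G]`, and unitary values make the linear extension preserve the involution. -/
theorem IsGroupProduct.isStarAlgProduct (hP : IsGroupProduct H φ ψ) :
    IsStarAlgProduct (fun i j => groupAlgMap (H i j).subtype)
      (fun i j => groupAlgCongr (φ i j)) (fun i => groupAlgMap (ψ i)) where
  comm := hP.isAlgProduct.comm
  generates := hP.adjoin_groupAlg
  existsUnique_lift C _ _ _ _ f hf := by
    obtain ⟨F, hF⟩ := hP.exists_lift (fun i => unitaryHom (f i)) fun i j hij h => by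
      ext
      have := hf i j hij (MonoidAlgebra.single h 1)
      change f i (groupAlgMap _ _) = f j (groupAlgMap _ (groupAlgMap _ _)) at this
      rw [groupAlgMap_single, groupAlgMap_single, groupAlgMap_single] at this
      exact this
    refine ⟨unitaryLift F, fun i => starAlgHom_ext fun g => ?_,
      fun F' hF' => starAlgHom_ext fun x => ?_⟩
    · simp [groupAlgMap_single, unitaryLift_single, hF, coe_unitaryHom]
    · have h : unitaryHom F' = F := hP.hom_ext fun i g => by
        ext
        simp [hF, coe_unitaryHom, ← hF' i, groupAlgMap_single]
      simp [← h, coe_unitaryHom, unitaryLift_single]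

end Products

/-! ### States of a C*-algebra and the GNS representation. -/

section States

theorem eq_ofReal_of_norm_le_re {z : ℂ} {r : ℝ} (h : ‖z‖ ≤ r) (h' : r ≤ z.re) : z = r := by
  have hz : z.re = ‖z‖ := z.re_le_norm.antisymm (h.trans h')
  have him : z.im = 0 := (Complex.abs_re_eq_norm).1 (by rw [hz, abs_norm])
  exact Complex.ext (by rw [Complex.ofReal_re]; exact (hz.trans_le h).antisymm h') him

variable {A : Type u} [CStarAlgebra A]

/-- A functional of norm at most one that takes the value one at the unit is real on selfadjoint
elements. -/
theorem im_apply_eq_zero {g : A →L[ℂ] ℂ} (hg : ‖g‖ ≤ 1) (h1 : g 1 = 1) {a : A}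
    (ha : IsSelfAdjoint a) : (g a).im = 0 := by
  -- Evaluate `g` at `a + it`. Both squared bounds grow like `t ^ 2`, which cancels and leaves a
  -- bound on a linear function of `t`; its slope `2 * (g a).im` must vanish.
  have key : ∀ t : ℝ, ((g a).im + t) ^ 2 ≤ ‖a‖ ^ 2 + ‖(1 : A)‖ * t ^ 2 := fun t => by
    have h2 : ‖g (a + (t * Complex.I : ℂ) • 1)‖ ≤ ‖a + (t * Complex.I : ℂ) • (1 : A)‖ := by
      simpa only [one_mul] using g.le_of_opNorm_le hg _
    have h3 : ‖a + (t * Complex.I : ℂ) • (1 : A)‖ ^ 2 ≤ ‖a‖ ^ 2 + ‖(1 : A)‖ * t ^ 2 := by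
      rw [sq, ← CStarRing.norm_star_mul_self]
      have : star (a + (t * Complex.I : ℂ) • (1 : A)) * (a + (t * Complex.I : ℂ) • (1 : A))
          = a * a + ((t ^ 2 : ℝ) : ℂ) • (1 : A) := by
        simp only [star_add, ha.star_eq, star_smul, star_one, add_mul, mul_add, smul_mul_assoc,
          mul_smul_comm, mul_one, one_mul]
        simp only [RCLike.star_def, map_mul, Complex.conj_ofReal, Complex.conj_I, mul_neg, neg_smul]
        have : -(↑t * Complex.I) * (↑t * Complex.I) = ((t ^ 2 : ℝ) : ℂ) := by
          push_cast
          linear_combination (-(t : ℂ) ^ 2) * Complex.I_sq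
        rw [← this]
        module
      rw [this]
      refine (norm_add_le _ _).trans ?_
      rw [norm_smul, Complex.norm_real, Real.norm_of_nonneg (sq_nonneg t), mul_comm (t ^ 2)]
      gcongr
      rw [sq]
      exact norm_mul_le a a
    have h4 : |(g a).im + t| ≤ ‖g (a + (t * Complex.I : ℂ) • 1)‖ := by
      simpa [h1] using Complex.abs_im_le_norm (g (a + (t * Complex.I : ℂ) • 1))
    calc ((g a).im + t) ^ 2 = |(g a).im + t| ^ 2 := (sq_abs _).symm
      _ ≤ ‖a + (t * Complex.I : ℂ) • (1 : A)‖ ^ 2 := by gcongr; exact h4.trans h2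
      _ ≤ _ := h3
  have hA : ‖(1 : A)‖ ≤ 1 := by
    nontriviality A
    exact CStarRing.norm_one.le
  have key' : ∀ t : ℝ, 2 * (g a).im * t ≤ ‖a‖ ^ 2 := fun t => by
    nlinarith [key t, sq_nonneg t, sq_nonneg (g a).im]
  by_contra h
  -- This `t` makes the left side equal to `‖a‖ ^ 2 + 1`.
  have := key' ((‖a‖ ^ 2 + 1) / (2 * (g a).im))
  rw [mul_div_cancel₀ _ (by simpa using h)] at this
  linarith

variable [PartialOrder A] [StarOrderedRing A]

open scoped ComplexOrder in
-- From `0 ≤ ‖a‖ - a ≤ ‖a‖` the element `‖a‖ - a` has norm at most `‖a‖`. Hence `g a` lies within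
-- `‖a‖` of the number `‖a‖`, which forces a nonnegative real part.
theorem apply_nonneg {g : A →L[ℂ] ℂ} (hg : ‖g‖ ≤ 1) (h1 : g 1 = 1) {a : A} (ha : 0 ≤ a) :
    0 ≤ g a := by
  rw [Complex.nonneg_iff]
  refine ⟨?_, (im_apply_eq_zero hg h1 (IsSelfAdjoint.of_nonneg ha)).symm⟩
  have h2 : ‖algebraMap ℝ A ‖a‖ - a‖ ≤ ‖a‖ := by
    have h3 : 0 ≤ algebraMap ℝ A ‖a‖ - a :=
      sub_nonneg.2 (IsSelfAdjoint.of_nonneg ha).le_algebraMap_norm_self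
    rw [CStarAlgebra.norm_le_iff_le_algebraMap _ (norm_nonneg a) h3]
    exact sub_le_self _ ha
  have h4 : ‖g (algebraMap ℝ A ‖a‖ - a)‖ ≤ ‖a‖ := 
    (g.le_of_opNorm_le hg _).trans (by rwa [one_mul])
  have h5 : g (algebraMap ℝ A ‖a‖ - a) = ‖a‖ - g a := by
    rw [map_sub, Algebra.algebraMap_eq_smul_one, ← Complex.coe_smul, map_smul, h1, smul_eq_mul,
      mul_one]
  rw [h5] at h4
  have h6 := (Complex.abs_re_le_norm _).trans h4
  simp only [Complex.sub_re, Complex.ofReal_re] at h6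
  linarith [(abs_le.1 h6).2]

open scoped ComplexOrder in
/-- Every positive element of a C*-algebra attains its norm at some state. -/
theorem exists_state_apply_eq_norm [Nontrivial A] {b : A} (hb : 0 ≤ b) :
    ∃ f : A →ₚ[ℂ] ℂ, f 1 = 1 ∧ f b = ‖b‖ := by
  -- A norming functional of `1 + b` norms `1` and `b` simultaneously: `‖b‖` is in the spectrum of
  -- `b`, so `‖1 + b‖ ≥ 1 + ‖b‖`, while `‖g 1‖ ≤ 1` and `‖g b‖ ≤ ‖b‖`. Both bounds must be
  -- equalities.
  obtain ⟨g, hg, hgx⟩ := exists_dual_vector' ℂ (1 + b)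
  have hx : 1 + ‖b‖ ≤ ‖1 + b‖ := by
    have h := spectrum.norm_le_norm_of_mem
      (spectrum.add_mem_add_iff.2 (CStarAlgebra.norm_mem_spectrum_of_nonneg hb) :
        ‖b‖ + 1 ∈ spectrum ℝ (algebraMap ℝ A 1 + b))
    rw [map_one, add_comm] at h
    exact (le_abs_self _).trans h
  have hgb : ‖g b‖ ≤ ‖b‖ := by simpa using g.le_of_opNorm_le hg.le b
  have hg1 : ‖g 1‖ ≤ 1 := by simpa using g.le_of_opNorm_le hg.le 1
  rw [map_add] at hgx
  have hre := congrArg Complex.re hgx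
  simp only [Complex.add_re, RCLike.ofReal_eq_complex_ofReal, Complex.ofReal_re] at hre
  have h1 : g 1 = 1 := by
    rw [eq_ofReal_of_norm_le_re hg1 (by linarith [(g b).re_le_norm]), Complex.ofReal_one]
  have hb' : g b = ‖b‖ := eq_ofReal_of_norm_le_re hgb (by linarith [(g 1).re_le_norm])
  exact ⟨PositiveLinearMap.mk₀ (g : A →ₗ[ℂ] ℂ) fun x hx => apply_nonneg hg.le h1 hx, h1, hb'⟩

end States

/-- Every element of a C*-algebra attains its norm in some unital representation on a Hilbert
space. -/
theorem exists_norm_le_norm_rep {A : Type u} [CStarAlgebra A] [Nontrivial A] (a : A) :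
    ∃ (E : Type u) (_ : NormedAddCommGroup E) (_ : InnerProductSpace ℂ E) (_ : CompleteSpace E)
      (π : A →⋆ₐ[ℂ] (E →L[ℂ] E)), ‖a‖ ≤ ‖π a‖ := by
  let : PartialOrder A := CStarAlgebra.spectralOrder A
  have : StarOrderedRing A := CStarAlgebra.spectralOrderedRing A
  -- For this state the class of `1` is a unit vector, and `a` sends it to the class of `a`, whose
  -- squared norm is `f (star a * a) = ‖a‖ ^ 2`.
  obtain ⟨f, h1, hf⟩ := exists_state_apply_eq_norm (star_mul_self_nonneg a)
  refine ⟨f.GNS, inferInstance, inferInstance, inferInstance, f.gnsStarAlgHom, ?_⟩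
  have hone : ‖f.toPreGNS 1‖ = 1 := by
    rw [f.preGNS_norm_def]
    simp [h1]
  have ha : ‖f.toPreGNS a‖ = ‖a‖ := by
    rw [f.preGNS_norm_def]
    simp [hf, CStarRing.norm_star_mul_self]
  have h := (f.gnsStarAlgHom a).le_opNorm (f.toPreGNS 1)
  have h2 : f.gnsStarAlgHom a (f.toPreGNS 1) = f.toPreGNS a := by
    simp
  rwa [h2, UniformSpace.Completion.norm_coe, UniformSpace.Completion.norm_coe, hone, ha,
    mul_one] at h

/-! ### The universal property of `C*(G)`. -/

section Lift

variable {G : Type u} [Group G] {D : Type u} [CStarAlgebra D]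

/-- The full norm dominates the norm in every unitary representation in a C*-algebra. -/
theorem norm_unitaryLift_le (u : G →* unitary D) (x : MonoidAlgebra ℂ G) :
    ‖unitaryLift u x‖ ≤ fullNorm x := by
  rcases subsingleton_or_nontrivial D with h | h
  · rw [Subsingleton.elim (unitaryLift u x) 0, norm_zero]
    exact fullNorm_nonneg x
  -- Composing `u` with a representation of `D` that attains the norm gives a unitary representation
  -- of `G` on a Hilbert space, one of those in the supremum.
  obtain ⟨E, _, _, _, π, hπ⟩ := exists_norm_le_norm_rep (unitaryLift u x)
  let v : G →* unitary (E →L[ℂ] E) :=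
    ((π : D →* (E →L[ℂ] E)).comp ((unitary D).subtype.comp u)).codRestrict _
      fun g => Unitary.map_mem π (u g).2
  have h (x : MonoidAlgebra ℂ G) : π (unitaryLift u x) = repExt v x := by
    induction x using MonoidAlgebra.induction_linear with
    | zero => simp
    | add x y hx hy => simp only [map_add, hx, hy]
    | single g c =>
      rw [unitaryLift_single, map_smul, repExt_single]
      rfl
  rw [h] at hπ
  exact hπ.trans (norm_repExt_le_fullNorm v x)

namespace GroupCStar

/-- The image of a group element in the full group C*-algebra. -/
noncomputable def of (g : G) : GroupCStar G := incl (MonoidAlgebra.single g 1 : MonoidAlgebra ℂ G)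

theorem of_one : of (1 : G) = 1 := rfl

theorem of_mul (g h : G) : of (g * h) = of g * of h := by
  refine Eq.trans (congrArg incl ?_) (incl_mul _ _)
  exact ((MonoidAlgebra.of ℂ G).map_mul g h)

theorem star_of (g : G) : star (of g) = of g⁻¹ := by
  refine (star_incl _).trans (congrArg incl ?_)
  exact (star_single g 1).trans (by rw [star_one])

theorem of_mem_unitary (g : G) : of g ∈ unitary (GroupCStar G) := by
  rw [Unitary.mem_iff, star_of, ← of_mul, ← of_mul, inv_mul_cancel, mul_inv_cancel, of_one]
  exact ⟨rfl, rfl⟩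

theorem map_of {K : Type u} [Group K] (f : G →* K) (g : G) : map f (of g) = of (f g) :=
  (map_incl f _).trans (congrArg incl (groupAlgMap_single f g 1))

/-- A closed subspace of the full group C*-algebra that contains the group contains
everything. -/
theorem eq_top_of_of_mem {S : Submodule ℂ (GroupCStar G)} (hS : IsClosed (S : Set (GroupCStar G)))
    (h : ∀ g, of g ∈ S) (x : GroupCStar G) : x ∈ S := by
  induction x using induction with
  | hp => exact hS
  | h x =>
    change MonoidAlgebra ℂ G at x
    induction x using MonoidAlgebra.induction_linear with
    | zero => exact zero_mem S
    | add x y hx hy =>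
      exact Set.mem_of_eq_of_mem (s := (S : Set (GroupCStar G))) (incl_add (G := G) x y)
        (add_mem hx hy)
    | single g c =>
      have hc : (MonoidAlgebra.single g c : MonoidAlgebra ℂ G)
          = c • (MonoidAlgebra.single g 1 : MonoidAlgebra ℂ G) := by simp
      rw [hc]
      exact Set.mem_of_eq_of_mem (s := (S : Set (GroupCStar G)))
        (incl_smul (G := G) c (MonoidAlgebra.single g 1 : MonoidAlgebra ℂ G)) (S.smul_mem c (h g))

open scoped CStarAlgebra in
theorem starAlgHom_ext {f f' : GroupCStar G →⋆ₐ[ℂ] D} (h : ∀ g, f (of g) = f' (of g)) :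
    f = f' := by
  have hc : IsClosed {x | f x = f' x} := isClosed_eq (map_continuous f) (map_continuous f')
  exact StarAlgHom.ext fun x => eq_top_of_of_mem
    (S := LinearMap.eqLocus (f : GroupCStar G →ₗ[ℂ] D) (f' : GroupCStar G →ₗ[ℂ] D)) hc h x

/-- The restriction to the group of a *-homomorphism on the full group C*-algebra. -/
noncomputable def unitaryHom (f : GroupCStar G →⋆ₐ[ℂ] D) : G →* unitary D where
  toFun g := ⟨f (of g), Unitary.map_mem f (of_mem_unitary g)⟩
  map_one' := Subtype.ext (map_one f)
  map_mul' g h := Subtype.ext ((congrArg f (of_mul g h)).trans (map_mul f _ _))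

theorem coe_unitaryHom (f : GroupCStar G →⋆ₐ[ℂ] D) (g : G) : (unitaryHom f g : D) = f (of g) := rfl

/-- The *-homomorphism of `FullPre G` given by a homomorphism to a unitary group. -/
noncomputable def preLift (u : G →* unitary D) : FullPre G →⋆ₐ[ℂ] D := unitaryLift u

theorem continuous_preLift (u : G →* unitary D) : Continuous (preLift u) :=
  AddMonoidHomClass.continuous_of_bound (preLift u) 1 fun x => by
    rw [one_mul]
    exact norm_unitaryLift_le u x

theorem uniformContinuous_preLift (u : G →* unitary D) : UniformContinuous (preLift u) :=
  uniformContinuous_addMonoidHom_of_continuous (continuous_preLift u)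

open UniformSpace in
/-- The continuous extension of `preLift u` to the full group C*-algebra. -/
noncomputable def liftFun (u : G →* unitary D) : GroupCStar G → D := Completion.extension (preLift u)

theorem continuous_liftFun (u : G →* unitary D) : Continuous (liftFun u) :=
  UniformSpace.Completion.continuous_extension

theorem liftFun_incl (u : G →* unitary D) (x : FullPre G) : liftFun u (incl x) = preLift u x :=
  UniformSpace.Completion.extension_coe (uniformContinuous_preLift u) x

/-- The *-homomorphism from the full group C*-algebra to a C*-algebra that extends a
homomorphism of the group to the unitary group. -/
noncomputable def lift (u : G →* unitary D) : GroupCStar G →⋆ₐ[ℂ] D where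
  toFun := liftFun u
  map_one' := (liftFun_incl u 1).trans (map_one (preLift u))
  map_mul' x y := by
    induction x using induction with
    | hp => exact isClosed_eq ((continuous_liftFun u).comp (continuous_mul_const y))
              ((continuous_mul_const _).comp (continuous_liftFun u))
    | h x =>
      induction y using induction with
      | hp => exact isClosed_eq ((continuous_liftFun u).comp (continuous_const_mul _))
                ((continuous_const_mul _).comp (continuous_liftFun u))
      | h y => rw [← incl_mul, liftFun_incl, liftFun_incl, liftFun_incl, map_mul]
  map_zero' := (liftFun_incl u 0).trans (map_zero (preLift u))
  map_add' x y := by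
    induction x using induction with
    | hp => exact isClosed_eq ((continuous_liftFun u).comp (continuous_add_const y))
              ((continuous_add_const _).comp (continuous_liftFun u))
    | h x =>
      induction y using induction with
      | hp => exact isClosed_eq ((continuous_liftFun u).comp (continuous_const_add _))
                ((continuous_const_add _).comp (continuous_liftFun u))
      | h y => rw [← incl_add, liftFun_incl, liftFun_incl, liftFun_incl, map_add]
  commutes' c := (liftFun_incl u (algebraMap ℂ _ c)).trans (AlgHomClass.commutes (preLift u) c)
  map_star' x := by
    induction x using induction with
    | hp => exact isClosed_eq ((continuous_liftFun u).comp continuous_star')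
              (continuous_star.comp (continuous_liftFun u))
    | h x => rw [star_incl, liftFun_incl, liftFun_incl, map_star]

theorem lift_of (u : G →* unitary D) (g : G) : lift u (of g) = u g :=
  (liftFun_incl u _).trans ((unitaryLift_single u g 1).trans (one_smul _ _))

end GroupCStar

end Lift

/-! ### Induced representations. -/

section Induced

variable {G : Type u} [Group G] (K : Subgroup G)

open scoped Classical in
/-- A system of representatives of the left cosets of `K` that contains the unit element. -/
noncomputable def cosetRep (q : G ⧸ K) : G := if q = (1 : G) then 1 else q.out

theorem cosetRep_one : cosetRep K ((1 : G) : G ⧸ K) = 1 := if_pos rfl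

theorem mk_cosetRep (q : G ⧸ K) : ((cosetRep K q : G) : G ⧸ K) = q := by
  unfold cosetRep
  split_ifs with h
  · exact h.symm
  · exact QuotientGroup.out_eq' q

/-- The cocycle `G × G ⧸ K → K` that describes the action of `G` on itself in terms of
representatives of the left cosets of `K`. -/
noncomputable def cosetCocycle (g : G) (q : G ⧸ K) : K :=
  ⟨(cosetRep K (g • q))⁻¹ * (g * cosetRep K q), by
    rw [← QuotientGroup.eq, mk_cosetRep, ← smul_eq_mul, ← MulAction.Quotient.smul_coe,
      mk_cosetRep]⟩

theorem coe_cosetCocycle (g : G) (q : G ⧸ K) :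
    (cosetCocycle K g q : G) = (cosetRep K (g • q))⁻¹ * (g * cosetRep K q) := rfl

theorem cosetCocycle_one (q : G ⧸ K) : cosetCocycle K 1 q = 1 := by
  ext
  simp [coe_cosetCocycle]

theorem cosetCocycle_mul (g h : G) (q : G ⧸ K) :
    cosetCocycle K (g * h) q = cosetCocycle K g (h • q) * cosetCocycle K h q := by
  ext
  simp [coe_cosetCocycle, mul_smul, mul_assoc]

theorem smul_coset_one (k : K) : (k : G) • ((1 : G) : G ⧸ K) = (1 : G) := by
  rw [MulAction.Quotient.smul_coe, QuotientGroup.eq]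
  simp

/-- The trivial coset is represented by `1`, so over it the cocycle is the identity of `K` rather
than a conjugation. This makes the fibre there a copy of the original representation. -/
theorem cosetCocycle_coset_one (k : K) : cosetCocycle K (k : G) (1 : G) = k := by
  ext
  rw [coe_cosetCocycle, smul_coset_one, cosetRep_one]
  simp

variable {E : Type u} [NormedAddCommGroup E]

open scoped Classical in
/-- The vector of the induced representation that is supported at the coset of the unit. -/
noncomputable def baseVector (v : E) : lp (fun _ : G ⧸ K => E) 2 :=
  lp.single 2 ((1 : G) : G ⧸ K) v

theorem norm_baseVector (v : E) : ‖baseVector K v‖ = ‖v‖ := by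
  classical exact lp.norm_single two_pos _ _

variable {K} [InnerProductSpace ℂ E] [CompleteSpace E]
  (π : K →* unitary (E →L[ℂ] E))

theorem norm_unitary_apply (u : unitary (E →L[ℂ] E)) (v : E) : ‖(u : E →L[ℂ] E) v‖ = ‖v‖ :=
  ContinuousLinearMap.norm_map_of_mem_unitary u.2 v

/-- The action of `G` on functions `G ⧸ K → E` that is induced by a unitary representation of the
subgroup `K` on `E`. -/
noncomputable def inducedFun (g : G) (ξ : G ⧸ K → E) (q : G ⧸ K) : E :=
  (π (cosetCocycle K g (g⁻¹ • q)) : E →L[ℂ] E) (ξ (g⁻¹ • q))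

/-- The fibre maps are unitary, so the action merely permutes the norms of the values; both `ℓ²`
membership and isometry follow. -/
theorem norm_inducedFun (g : G) (ξ : G ⧸ K → E) (q : G ⧸ K) :
    ‖inducedFun π g ξ q‖ = ‖ξ (g⁻¹ • q)‖ := norm_unitary_apply _ _

theorem inducedFun_one (ξ : G ⧸ K → E) : inducedFun π 1 ξ = ξ := by
  ext q
  simp [inducedFun, cosetCocycle_one]

theorem inducedFun_mul (g h : G) (ξ : G ⧸ K → E) :
    inducedFun π (g * h) ξ = inducedFun π g (inducedFun π h ξ) := by
  ext q
  simp [inducedFun, cosetCocycle_mul, mul_smul]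

theorem memℓp_inducedFun (g : G) {ξ : G ⧸ K → E} (hξ : Memℓp ξ 2) :
    Memℓp (inducedFun π g ξ) 2 := by
  rw [memℓp_gen_iff (by norm_num)] at hξ ⊢
  simp only [norm_inducedFun]
  exact (MulAction.toPerm g⁻¹).summable_iff (f := fun q => ‖ξ q‖ ^ (2 : ENNReal).toReal) |>.2 hξ

/-- The action of a group element in the induced representation, as a linear map. -/
noncomputable def inducedLin (g : G) : lp (fun _ : G ⧸ K => E) 2 →ₗ[ℂ] lp (fun _ : G ⧸ K => E) 2 where
  toFun ξ := ⟨inducedFun π g ξ, memℓp_inducedFun π g (lp.memℓp ξ)⟩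
  map_add' ξ η := by
    ext q
    exact map_add (π _ : E →L[ℂ] E) _ _
  map_smul' c ξ := by
    ext q
    exact map_smul (π _ : E →L[ℂ] E) _ _

theorem coe_inducedLin (g : G) (ξ : lp (fun _ : G ⧸ K => E) 2) :
    ⇑(inducedLin π g ξ) = inducedFun π g ξ := rfl

theorem inducedLin_one : inducedLin π 1 = 1 :=
  LinearMap.ext fun ξ => lp.ext (inducedFun_one π ξ)

theorem inducedLin_mul (g h : G) : inducedLin π (g * h) = inducedLin π g * inducedLin π h :=
  LinearMap.ext fun ξ => lp.ext (inducedFun_mul π g h ξ)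

theorem norm_inducedLin (g : G) (ξ : lp (fun _ : G ⧸ K => E) 2) : ‖inducedLin π g ξ‖ = ‖ξ‖ := by
  have h : 0 < (2 : ENNReal).toReal := by norm_num
  rw [lp.norm_eq_tsum_rpow h, lp.norm_eq_tsum_rpow h, coe_inducedLin]
  simp only [norm_inducedFun]
  congr 1
  exact (MulAction.toPerm g⁻¹).tsum_eq fun q => ‖ξ q‖ ^ (2 : ENNReal).toReal

/-- The action of a group element in the induced representation, as an isometry. -/
noncomputable def inducedIso (g : G) : lp (fun _ : G ⧸ K => E) 2 ≃ₗᵢ[ℂ] lp (fun _ : G ⧸ K => E) 2 where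
  toLinearEquiv := LinearEquiv.ofLinearMap (inducedLin π g) (inducedLin π g⁻¹)
    (by rw [← Module.End.mul_eq_comp, ← inducedLin_mul, mul_inv_cancel, inducedLin_one]; rfl)
    (by rw [← Module.End.mul_eq_comp, ← inducedLin_mul, inv_mul_cancel, inducedLin_one]; rfl)
  norm_map' := norm_inducedLin π g

/-- The unitary representation of `G` induced by a unitary representation of a subgroup. -/
noncomputable def inducedRep :
    G →* unitary (lp (fun _ : G ⧸ K => E) 2 →L[ℂ] lp (fun _ : G ⧸ K => E) 2) :=
  Unitary.linearIsometryEquiv.symm.toMonoidHom.comp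
    { toFun := inducedIso π
      map_one' := LinearIsometryEquiv.ext fun ξ => DFunLike.congr_fun (inducedLin_one π) ξ
      map_mul' := fun g h =>
        LinearIsometryEquiv.ext fun ξ => DFunLike.congr_fun (inducedLin_mul π g h) ξ }

theorem coe_inducedRep_apply (g : G) (ξ : lp (fun _ : G ⧸ K => E) 2) :
    ⇑((inducedRep π g : lp (fun _ : G ⧸ K => E) 2 →L[ℂ] lp (fun _ : G ⧸ K => E) 2) ξ)
      = inducedFun π g ξ := rfl

/-- The restriction to `K` of the induced representation contains the original representation. -/
theorem inducedRep_baseVector (k : K) (v : E) :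
    (inducedRep π (k : G) : lp (fun _ : G ⧸ K => E) 2 →L[ℂ] lp (fun _ : G ⧸ K => E) 2)
      (baseVector K v) = baseVector K ((π k : E →L[ℂ] E) v) := by
  classical
  ext q
  rw [coe_inducedRep_apply, baseVector, baseVector]
  -- `K` fixes the trivial coset, hence preserves its complement, where both sides vanish.
  by_cases hq : q = (1 : G)
  · subst hq
    have h : (k : G)⁻¹ • ((1 : G) : G ⧸ K) = (1 : G) := smul_coset_one K k⁻¹
    rw [inducedFun, h, cosetCocycle_coset_one, lp.single_apply_self, lp.single_apply_self]
  · have h : (k : G)⁻¹ • q ≠ (1 : G) := fun h => hq (by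
      rw [← smul_coset_one K k, ← h, smul_inv_smul])
    rw [inducedFun, lp.single_apply_ne _ _ _ h, map_zero, lp.single_apply_ne _ _ _ hq]

theorem repExt_inducedRep_baseVector (x : MonoidAlgebra ℂ K) (v : E) :
    repExt (inducedRep π) (groupAlgMap K.subtype x) (baseVector K v)
      = baseVector K (repExt π x v) := by
  classical
  induction x using MonoidAlgebra.induction_linear with
  | zero => simp [baseVector]
  | add x y hx hy =>
    simp only [map_add, add_apply, hx, hy]
    exact (lp.single_add _ _ _ _).symm
  | single k c =>
    rw [groupAlgMap_single, repExt_single, repExt_single, smul_apply, smul_apply]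
    refine (congrArg (c • ·) (inducedRep_baseVector π k v)).trans ?_
    exact (lp.single_smul _ _ _ _).symm

/-- `baseVector` embeds `E` isometrically and intertwines `π` with the induced representation, whose
norm at the image of `x` is bounded by the full norm over `G`. -/
theorem norm_repExt_le_fullNorm_map (x : MonoidAlgebra ℂ K) :
    ‖repExt π x‖ ≤ fullNorm (groupAlgMap K.subtype x) := by
  refine ContinuousLinearMap.opNorm_le_bound _ (fullNorm_nonneg _) fun v => ?_
  have h := (repExt (inducedRep π) (groupAlgMap K.subtype x)).le_of_opNorm_le
    (norm_repExt_le_fullNorm _ _) (baseVector K v)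
  rwa [repExt_inducedRep_baseVector, norm_baseVector, norm_baseVector] at h

end Induced

/-! ### Injective group homomorphisms induce isometries of `C*(G)`. -/

variable {G K : Type u} [Group G] [Group K]

theorem fullNorm_subtype (S : Subgroup G) (x : MonoidAlgebra ℂ S) :
    fullNorm (groupAlgMap S.subtype x) = fullNorm x :=
  (fullNorm_map_le _ x).antisymm
    (fullNorm_le (fullNorm_nonneg _) fun _ _ _ _ π => norm_repExt_le_fullNorm_map π x)

/-- An injective `f` is an isomorphism onto its range followed by an inclusion of a subgroup. The
inclusion preserves the full norm, and the inverse of the isomorphism is contractive. -/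
theorem fullNorm_map_of_injective {f : G →* K} (hf : Function.Injective f)
    (x : MonoidAlgebra ℂ G) : fullNorm (groupAlgMap f x) = fullNorm x := by
  refine (fullNorm_map_le f x).antisymm ?_
  have h : x = groupAlgMap (MonoidHom.ofInjective hf).symm.toMonoidHom
      (groupAlgMap f.rangeRestrict x) := by
    rw [groupAlgMap_comp, show (MonoidHom.ofInjective hf).symm.toMonoidHom.comp f.rangeRestrict
      = MonoidHom.id G from MonoidHom.ext fun g => (MonoidHom.ofInjective hf).symm_apply_apply g,
      groupAlgMap_id]
  calc fullNorm x ≤ fullNorm (groupAlgMap f.rangeRestrict x) := by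
        conv_lhs => rw [h]
        exact fullNorm_map_le _ _
    _ = fullNorm (groupAlgMap f x) := by
        rw [← fullNorm_subtype, groupAlgMap_comp, MonoidHom.subtype_comp_rangeRestrict]

/-- The *-homomorphism of full group C*-algebras induced by an injective homomorphism of groups
is isometric. -/
theorem GroupCStar.norm_map {f : G →* K} (hf : Function.Injective f) (x : GroupCStar G) :
    ‖GroupCStar.map f x‖ = ‖x‖ := by
  induction x using GroupCStar.induction with
  | hp => exact isClosed_eq (continuous_norm.comp (GroupCStar.continuous_mapFun f)) continuous_norm
  | h x =>
    rw [GroupCStar.map_incl, GroupCStar.norm_incl, GroupCStar.norm_incl]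
    exact fullNorm_map_of_injective hf x

theorem GroupCStar.map_injective {f : G →* K} (hf : Function.Injective f) :
    Function.Injective (GroupCStar.map f) :=
  (AddMonoidHomClass.isometry_of_norm (GroupCStar.map f) (GroupCStar.norm_map hf)).injective

/-! ### The C*-algebra `C*(P)` as a generalized free product. -/

section CStarProduct

variable {I : Type u} {G : I → Type u} [∀ i, Group (G i)]
  {H : ∀ i, I → Subgroup (G i)} {φ : ∀ i j, H i j ≃* H j i}
  {P : Type u} [Group P] {ψ : ∀ i, G i →* P}

theorem IsGroupProduct.adjoin_groupCStar (hP : IsGroupProduct H φ ψ) :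
    (StarAlgebra.adjoin ℂ (⋃ i, Set.range (GroupCStar.map (ψ i)))).topologicalClosure = ⊤ := by
  set S := (StarAlgebra.adjoin ℂ (⋃ i, Set.range (GroupCStar.map (ψ i)))).topologicalClosure
    with hS
  have key : ∀ x : P, GroupCStar.of x ∈ S := by
    refine hP.induction (fun i g => ?_) ?_ (fun x y hx hy => ?_) fun x hx => ?_
    · refine StarSubalgebra.le_topologicalClosure _ (StarAlgebra.subset_adjoin _ _ ?_)
      exact Set.mem_iUnion.2 ⟨i, GroupCStar.of g, GroupCStar.map_of (ψ i) g⟩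
    · rw [GroupCStar.of_one]
      exact one_mem S
    · rw [GroupCStar.of_mul]
      exact mul_mem hx hy
    · rw [← GroupCStar.star_of]
      exact star_mem hx
  exact StarSubalgebra.eq_top_iff.2 (GroupCStar.eq_top_of_of_mem
    (S := Subalgebra.toSubmodule S.toSubalgebra)
    (StarSubalgebra.isClosed_topologicalClosure _) key)

theorem IsGroupProduct.isCStarProduct (hP : IsGroupProduct H φ ψ) :
    IsCStarProduct (fun i j => GroupCStar.map (H i j).subtype)
      (fun i j => GroupCStar.congr (φ i j)) (fun i => GroupCStar.map (ψ i)) where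
  comm i j hij b := by
    change GroupCStar.map _ (GroupCStar.map _ b)
      = GroupCStar.map _ (GroupCStar.map _ (GroupCStar.map _ b))
    rw [GroupCStar.map_comp, GroupCStar.map_comp, GroupCStar.map_comp]
    congr 1
    exact congrArg GroupCStar.map (MonoidHom.ext (hP.comm i j hij))
  generates := hP.adjoin_groupCStar
  existsUnique_lift D _ f hf := by
    obtain ⟨F, hF⟩ := hP.exists_lift (fun i => GroupCStar.unitaryHom (f i)) fun i j hij h => by
      ext
      have := hf i j hij (GroupCStar.of h)
      change f i (GroupCStar.map _ _) = f j (GroupCStar.map _ (GroupCStar.map _ _)) at this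
      rw [GroupCStar.map_of, GroupCStar.map_of, GroupCStar.map_of] at this
      exact this
    refine ⟨GroupCStar.lift F, fun i => GroupCStar.starAlgHom_ext fun g => ?_,
      fun F' hF' => GroupCStar.starAlgHom_ext fun x => ?_⟩
    · rw [StarAlgHom.comp_apply, GroupCStar.map_of, GroupCStar.lift_of, hF,
        GroupCStar.coe_unitaryHom]
    · have h : GroupCStar.unitaryHom F' = F := hP.hom_ext fun i g => by
        ext
        rw [hF, GroupCStar.coe_unitaryHom, GroupCStar.coe_unitaryHom, ← hF' i,
          StarAlgHom.comp_apply, GroupCStar.map_of]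
      rw [GroupCStar.lift_of, ← h, GroupCStar.coe_unitaryHom]

end CStarProduct

end GenFreeProd

theorem mainTheorem4 {I : Type u} {G : I → Type u} [∀ i, Group (G i)]
    (H : ∀ i, I → Subgroup (G i)) (φ : ∀ i j, H i j ≃* H j i)
    (hφ : ∀ i j, i ≠ j → φ j i = (φ i j).symm)
    (hG : GenFreeProd.GroupRealizable H φ) :
    (GenFreeProd.AlgRealizable
        (fun i j => MonoidAlgebra.mapDomainAlgHom ℂ ℂ (H i j).subtype)
        (fun i j => MonoidAlgebra.domCongr ℂ ℂ (φ i j)) ∧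
      GenFreeProd.StarAlgRealizable
        (fun i j => GenFreeProd.groupAlgMap (H i j).subtype)
        (fun i j => GenFreeProd.groupAlgCongr (φ i j))) ∧
    GenFreeProd.CStarRealizable
      (fun i j => GenFreeProd.GroupCStar.map (H i j).subtype)
      (fun i j => GenFreeProd.GroupCStar.congr (φ i j)) := by
  obtain ⟨P, _, ψ, hP, hψ⟩ := hG
  refine ⟨⟨⟨⟨fun i j _ => ?_, fun i j hij => ?_⟩, MonoidAlgebra ℂ P, inferInstance, inferInstance,
      _, hP.isAlgProduct, fun i => ?_⟩,
    ⟨⟨fun i j _ => ?_, fun i j hij => ?_⟩, MonoidAlgebra ℂ P, inferInstance, inferInstance,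
      inferInstance, inferInstance, _, hP.isStarAlgProduct, fun i => ?_⟩⟩,
    ⟨⟨fun i j _ => ?_, fun i j hij => ?_⟩, GenFreeProd.GroupCStar P, inferInstance,
      _, hP.isCStarProduct, fun i => ?_⟩⟩
  · exact GenFreeProd.groupAlgMap_injective (H i j).subtype_injective
  · rw [hφ i j hij]
    rfl
  · exact GenFreeProd.groupAlgMap_injective (hψ i)
  · exact GenFreeProd.groupAlgMap_injective (H i j).subtype_injective
  · rw [hφ i j hij]
    rfl
  · exact GenFreeProd.groupAlgMap_injective (hψ i)
  · exact GenFreeProd.GroupCStar.map_injective (H i j).subtype_injective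
  · rw [hφ i j hij]
    rfl
  · exact GenFreeProd.GroupCStar.map_injective (hψ i)
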